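/- Let $d\geq 1$ and $N\geq 3$ be integers, and write $N=p_1^{a_1}p_2^{a_2}\cdots p_s^{a_s}$ with primes $p_1<p_2<\dots<p_s$ and exponents $a_j\geq 1$. Let $T^d_N$ be the $d$-dimensional discrete torus, i.e. the Cayley graph of the group $(\mathbb{Z}/N\mathbb{Z})^d$ with respect to the generating set $\{\pm e_1,\dots,\pm e_d\}$, where $e_i$ is the element with $1$ in the $i$-th coordinate and $0$ in all others. By an eigenvalue of $T^d_N$ we mean an eigenvalue of its adjacency matrix. Let $\mathbb{N}=\{0,1,2,\dots\}$. If $s=1$, we set $p_2=\infty$. (i) If $2\nmid N$, then $0$ is an eigenvalue of $T^d_N$ if and only if $2d\in\mathbb{N}p_1+\cdots+\mathbb{N}p_s$. (ii) If $2\mid N$ and $d$ is even, then $0$ is an eigenvalue of $T^d_N$. (iii) If $2\mid N$, $d$ is odd and $p_2\leq d$, then $0$ is an eigenvalue of $T^d_N$. (iv) If $2\mid N$, $d$ is odd and $p_2>d$, then $0$ is an eigenvalue of $T^d_N$ if and only if $4\mid N$. -/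

import Mathlib

/-- The `d`-dimensional discrete torus `T^d_N`: the Cayley graph of the additive group
`(ℤ/Nℤ)^d` with respect to the generating set `{±e_1, …, ±e_d}`, where `e_i` is the
`i`-th canonical basis vector. -/
def discreteTorus (d N : ℕ) : SimpleGraph (Fin d → ZMod N) :=
  SimpleGraph.addCayley {g | ∃ i : Fin d, g = Pi.single i 1 ∨ g = -Pi.single i 1}

open Classical in
/-- `μ` is an eigenvalue of the finite graph `G`, i.e. an eigenvalue of its (real) adjacency
matrix. -/
def IsGraphEigenvalue {V : Type*} [Fintype V] (G : SimpleGraph V) (μ : ℝ) : Prop :=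
  Module.End.HasEigenvalue (Matrix.toLin' (G.adjMatrix ℝ)) μ

/-! The characters of the torus diagonalise its adjacency matrix, so `0` is an eigenvalue exactly
when `∑ (z i + (z i)⁻¹) = 0` for some `N`-th roots of unity `z 1, …, z d`.

Existence comes from explicit sums: pairs `1, -1`, the root `I` when `4 ∣ N`, and half polygons,
which take one member of each pair `{z, z⁻¹}` of nontrivial `p`-th roots and contribute `-1`.

Obstructions come from vanishing sums of roots of unity. For odd `N`, the Lam–Leung theorem puts the
length `2d` in the semigroup of the primes. If `N = 2M` with `M` odd, that semigroup contains `2`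
and says nothing; instead, replacing `z` by `-z` where `z ^ M = -1` yields an equality of two
natural combinations of `M`-th roots, of different weights since `d` is odd. `IsRigidBelow` rules
this out when all primes of `M` exceed `d`.

Both statements on roots of unity are proved by adjoining primes in increasing order. The `p * m`-th
roots are the products `ω ^ j * z` with `j < p` and `z ^ m = 1`. A relation among them forces the
`p` layers to vanish separately if `p ∣ m`, and to have equal values if not. -/

/-- If a combination of `1, ω, …, ω ^ (p - 1)` whose coefficients are integral combinations of the
family `f` vanishes, then all its coefficients agree. -/
def HasEqualCoefficients {I : Type*} [Fintype I] (p : ℕ) (ω : ℂ) (f : I → ℂ) : Prop :=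
  ∀ c : Fin p → I → ℤ, ∑ j : Fin p, ω ^ (j : ℕ) * ∑ i, (c j i : ℂ) * f i = 0 →
    ∀ j k, ∑ i, (c j i : ℂ) * f i = ∑ i, (c k i : ℂ) * f i

/-- If a combination of `1, ω, …, ω ^ (p - 1)` whose coefficients are integral combinations of the
family `f` vanishes, then all its coefficients vanish. -/
def HasZeroCoefficients {I : Type*} [Fintype I] (p : ℕ) (ω : ℂ) (f : I → ℂ) : Prop :=
  ∀ c : Fin p → I → ℤ, ∑ j : Fin p, ω ^ (j : ℕ) * ∑ i, (c j i : ℂ) * f i = 0 →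
    ∀ j, ∑ i, (c j i : ℂ) * f i = 0

/-- A natural combination of `f` of weight less than `q` can only be rewritten by enlarging it or
by using a combination of large weight. -/
def IsRigidBelow {I : Type*} [Fintype I] (f : I → ℂ) (q r : ℕ) : Prop :=
  ∀ x y : I → ℕ, ∑ i, (x i : ℂ) * f i = ∑ i, (y i : ℂ) * f i → ∑ i, x i < q →
    x ≤ y ∨ (q - ∑ i, x i) * (r - 1) ≤ ∑ i, y i

/-- The weights of the vanishing natural combinations of `f` lie in `S`. -/
def VanishingWeightsIn {I : Type*} [Fintype I] (f : I → ℂ) (S : AddSubmonoid ℕ) : Prop :=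
  ∀ x : I → ℕ, ∑ i, (x i : ℂ) * f i = 0 → ∑ i, x i ∈ S

/-! ### Passing rigidity and vanishing weights from `f` to its twists by powers of `ω` -/

theorem sum_prod_twist {I : Type*} [Fintype I] {p : ℕ} (ω : ℂ) (f : I → ℂ)
    (x : Fin p × I → ℕ) :
    ∑ a, (x a : ℂ) * (ω ^ (a.1 : ℕ) * f a.2) =
      ∑ j : Fin p, ω ^ (j : ℕ) * ∑ i, (x (j, i) : ℂ) * f i := by
  rw [Fintype.sum_prod_type]
  refine Finset.sum_congr rfl fun j _ => ?_
  rw [Finset.mul_sum]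
  exact Finset.sum_congr rfl fun i _ => by ring

theorem HasEqualCoefficients.apply_nat {I : Type*} [Fintype I] {p : ℕ} {ω : ℂ} {f : I → ℂ}
    (h : HasEqualCoefficients p ω f) {x y : Fin p × I → ℕ}
    (hxy : ∑ a, (x a : ℂ) * (ω ^ (a.1 : ℕ) * f a.2) =
      ∑ a, (y a : ℂ) * (ω ^ (a.1 : ℕ) * f a.2)) (j k : Fin p) :
    ∑ i, ((x (j, i) + y (k, i) : ℕ) : ℂ) * f i = ∑ i, ((x (k, i) + y (j, i) : ℕ) : ℂ) * f i := by
  rw [sum_prod_twist, sum_prod_twist, ← sub_eq_zero, ← Finset.sum_sub_distrib] at hxy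
  have := h (fun j i => (x (j, i) : ℤ) - y (j, i)) (by
    rw [← hxy]
    refine Finset.sum_congr rfl fun j _ => ?_
    rw [← mul_sub, ← Finset.sum_sub_distrib]
    congr 1
    exact Finset.sum_congr rfl fun i _ => by push_cast; ring) j k
  simp only [Int.cast_sub, Int.cast_natCast, sub_mul, Finset.sum_sub_distrib] at this
  simp only [Nat.cast_add, add_mul, Finset.sum_add_distrib]
  linear_combination this

/-- A lower bound for the number of vanishing members of a family of natural numbers. -/
theorem card_filter_eq_zero_add {p : ℕ} (X : Fin p → ℕ) (k : Fin p) (hk : X k ≠ 0) :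
    p + X k ≤ (Finset.univ.filter fun j => X j = 0).card + (∑ j, X j) + 1 := by
  have h1 : (Finset.univ.filter fun j => X j = 0).card +
      (Finset.univ.filter fun j => ¬ X j = 0).card = p := by
    rw [Finset.card_filter_add_card_filter_not]; simp
  set A := Finset.univ.filter fun j => ¬ X j = 0
  have hkA : k ∈ A := by simp [A, hk]
  have h2 : (A.erase k).card ≤ ∑ j ∈ A.erase k, X j := by
    rw [Finset.card_eq_sum_ones]
    refine Finset.sum_le_sum fun j hj => ?_
    have : X j ≠ 0 := by simpa [A] using Finset.mem_of_mem_erase hj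
    omega
  have h3 := Finset.sum_erase_add A X hkA
  have h4 : ∑ j ∈ A, X j ≤ ∑ j, X j := Finset.sum_le_sum_of_subset (Finset.subset_univ _)
  rw [Finset.card_erase_of_mem hkA] at h2
  omega

theorem exists_eq_zero_of_sum_lt {p : ℕ} (X : Fin p → ℕ) (h : ∑ j, X j < p) : ∃ j, X j = 0 := by
  by_contra! hc
  have : ∑ _j : Fin p, 1 ≤ ∑ j, X j :=
    Finset.sum_le_sum fun j _ => Nat.one_le_iff_ne_zero.2 (hc j)
  simp at this
  omega

/-- Some layers of `x` are empty because its weight is below `p`. Comparing a layer `k` where `x ≤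
y` fails with an empty layer `j₀` turns the relation into one for `f`, between `x k + y j₀` and `y
k`. Rigidity of `f` makes `y k` heavy unless `y j₀` is; the minimal choice of `j₀` then makes `y`
heavy on every empty layer. -/
theorem IsRigidBelow.prod {I : Type*} [Fintype I] {p q r : ℕ} {ω : ℂ} {f : I → ℂ}
    (hω : HasEqualCoefficients p ω f) (hf : IsRigidBelow f q r) (hq : 1 ≤ q) (hqr : q ≤ r)
    (hrp : r ≤ p) :
    IsRigidBelow (fun a : Fin p × I => ω ^ (a.1 : ℕ) * f a.2) q r := by
  intro x y hxy hx
  by_contra! hcon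
  obtain ⟨hle, hlt⟩ := hcon
  obtain ⟨⟨k, i₀⟩, hki⟩ : ∃ a, y a < x a := by simpa [Pi.le_def] using hle
  rw [Fintype.sum_prod_type] at hx hlt
  rw [Fintype.sum_prod_type] at hlt
  set X : Fin p → ℕ := fun j => ∑ i, x (j, i) with hX
  set Y : Fin p → ℕ := fun j => ∑ i, y (j, i) with hY
  change ∑ j, X j < q at hx
  change ∑ j, Y j < (q - ∑ j, X j) * (r - 1) at hlt
  set Z := Finset.univ.filter fun j => X j = 0
  have hZ : Z.Nonempty := by
    obtain ⟨j, hj⟩ := exists_eq_zero_of_sum_lt X (by omega)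
    exact ⟨j, by simp [Z, hj]⟩
  obtain ⟨j₀, hj₀, hmin⟩ := Z.exists_min_image Y hZ
  have hXj₀ : X j₀ = 0 := by simpa [Z] using hj₀
  have hx₀ : ∀ i, x (j₀, i) = 0 := fun i =>
    (Finset.sum_eq_zero_iff.1 hXj₀) i (Finset.mem_univ i)
  have hXk : X k ≠ 0 := fun h => by
    have := (Finset.sum_eq_zero_iff.1 h) i₀ (Finset.mem_univ _)
    omega
  have hcard := card_filter_eq_zero_add X k hXk
  have hXkT : X k ≤ ∑ j, X j := Finset.single_le_sum (fun _ _ => Nat.zero_le _) (Finset.mem_univ k)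
  have hkZ : k ∉ Z := by simpa [Z] using hXk
  have hYsum : Y k + Z.card * Y j₀ ≤ ∑ j, Y j := by
    calc Y k + Z.card * Y j₀ ≤ Y k + ∑ j ∈ Z, Y j := by
          gcongr
          simpa using Finset.card_nsmul_le_sum Z Y (Y j₀) hmin
      _ = ∑ j ∈ insert k Z, Y j := (Finset.sum_insert hkZ).symm
      _ ≤ ∑ j, Y j := Finset.sum_le_sum_of_subset (Finset.subset_univ _)
  have key : (q - (X k + Y j₀)) * (r - 1) ≤ Y k := by
    rcases Nat.lt_or_ge (X k + Y j₀) q with h | h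
    · have hrel := hω.apply_nat hxy k j₀
      simp only [hx₀, zero_add] at hrel
      have hs : ∑ i, (x (k, i) + y (j₀, i)) = X k + Y j₀ := Finset.sum_add_distrib
      rcases hf _ _ hrel (by rw [hs]; exact h) with h' | h'
      · have := h' i₀
        simp only at this
        omega
      · rwa [hs] at h'
    · simp [Nat.sub_eq_zero_of_le h]
  change p + X k ≤ Z.card + ∑ j, X j + 1 at hcard
  generalize ∑ j, X j = T at *
  generalize X k = t at *
  generalize Y j₀ = w at *
  generalize Y k = u at *
  generalize Z.card = z at *
  generalize ∑ j, Y j = V at *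
  -- The bound survives without truncated subtraction: its left side is nonpositive once `t + w ≥
  -- q`.
  have key' : ((q : ℤ) - (t + w)) * (r - 1) ≤ u := by
    rcases Nat.lt_or_ge (t + w) q with h | h
    · zify [h.le, (by omega : 1 ≤ r)] at key
      exact key
    · have : ((q : ℤ) - (t + w)) ≤ 0 := by omega
      have h2 : (0 : ℤ) ≤ r - 1 := by omega
      nlinarith
  zify [hx.le, (by omega : 1 ≤ r)] at hlt hYsum hcard
  have hz : (0 : ℤ) ≤ z - (p - 1 - (T - t)) := by omega
  have hw0 : (0 : ℤ) ≤ w := by omega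
  have ht : (1 : ℤ) ≤ t := by omega
  have htT : (t : ℤ) ≤ T := by omega
  have hzw : ((p : ℤ) - 1 - (T - t)) * w ≤ z * w := mul_le_mul_of_nonneg_right (by omega) hw0
  -- If `w ≥ q - 1`, the empty layers alone are heavy enough; otherwise the bound on `u` is needed
  -- as well.
  rcases le_or_gt (q : ℤ) (w + 1) with h | h
  · have h1 : ((p : ℤ) - T) * (q - 1) ≤ (p - 1 - (T - t)) * w :=
      mul_le_mul (by omega) (by omega) (by omega) (by omega)
    have h2 : ((r : ℤ) - T) * (q - 1) ≤ (p - T) * (q - 1) :=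
      mul_le_mul_of_nonneg_right (by omega) (by omega)
    have h3 : (0 : ℤ) ≤ (T - 1) * (r - q) := mul_nonneg (by omega) (by omega)
    have h4 : (0 : ℤ) ≤ u := by omega
    nlinarith
  · have h1 : ((r : ℤ) - 1 - (T - t)) * w ≤ (p - 1 - (T - t)) * w :=
      mul_le_mul_of_nonneg_right (by omega) hw0
    have h2 : (0 : ℤ) ≤ (T - t) * (r - 1 - w) := mul_nonneg (by omega) (by omega)
    nlinarith

theorem IsRigidBelow.prod_of_injective {I : Type*} [Fintype I] {p q : ℕ} {ω : ℂ} {f : I → ℂ}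
    (hω : HasEqualCoefficients p ω f)
    (hf : ∀ x y : I → ℕ, ∑ i, (x i : ℂ) * f i = ∑ i, (y i : ℂ) * f i → x = y) (hqp : q ≤ p)
    (r : ℕ) : IsRigidBelow (fun a : Fin p × I => ω ^ (a.1 : ℕ) * f a.2) q r := by
  intro x y hxy hx
  left
  rw [Fintype.sum_prod_type] at hx
  obtain ⟨j, hj⟩ := exists_eq_zero_of_sum_lt (fun j : Fin p => ∑ i, x (j, i)) (by omega)
  rintro ⟨k, i⟩
  have h1 : x (k, i) + y (j, i) = x (j, i) + y (k, i) :=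
    congrFun (hf _ _ (hω.apply_nat hxy k j)) i
  have h2 : x (j, i) = 0 := (Finset.sum_eq_zero_iff.1 hj) i (Finset.mem_univ i)
  change x (k, i) ≤ y (k, i)
  omega

theorem IsRigidBelow.prod_of_independent {I : Type*} [Fintype I] {p q r : ℕ} {ω : ℂ} {f : I → ℂ}
    (hω : HasZeroCoefficients p ω f) (hf : IsRigidBelow f q r) :
    IsRigidBelow (fun a : Fin p × I => ω ^ (a.1 : ℕ) * f a.2) q r := by
  intro x y hxy hx
  by_cases hle : x ≤ y
  · exact Or.inl hle
  right
  obtain ⟨⟨k, i₀⟩, hki⟩ : ∃ a, y a < x a := by simpa [Pi.le_def] using hle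
  rw [sum_prod_twist, sum_prod_twist, ← sub_eq_zero, ← Finset.sum_sub_distrib] at hxy
  have hrel := hω (fun j i => (x (j, i) : ℤ) - y (j, i)) (by
    rw [← hxy]
    refine Finset.sum_congr rfl fun j _ => ?_
    rw [← mul_sub, ← Finset.sum_sub_distrib]
    congr 1
    exact Finset.sum_congr rfl fun i _ => by push_cast; ring) k
  simp only [Int.cast_sub, Int.cast_natCast, sub_mul, Finset.sum_sub_distrib] at hrel
  rw [Fintype.sum_prod_type] at hx ⊢
  rw [Fintype.sum_prod_type]
  have hX : ∑ i, x (k, i) ≤ ∑ j, ∑ i, x (j, i) :=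
    Finset.single_le_sum (f := fun j => ∑ i, x (j, i)) (fun _ _ => Nat.zero_le _)
      (Finset.mem_univ k)
  have hY : ∑ i, y (k, i) ≤ ∑ j, ∑ i, y (j, i) :=
    Finset.single_le_sum (f := fun j => ∑ i, y (j, i)) (fun _ _ => Nat.zero_le _)
      (Finset.mem_univ k)
  rcases hf (fun i => x (k, i)) (fun i => y (k, i)) (sub_eq_zero.1 hrel) (by omega) with h | h
  · have := h i₀
    simp only at this
    omega
  · exact le_trans (Nat.mul_le_mul_right _ (by omega)) (h.trans hY)

theorem VanishingWeightsIn.prod_of_independent {I : Type*} [Fintype I] {p : ℕ} {ω : ℂ} {f : I → ℂ}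
    {S : AddSubmonoid ℕ}
    (hω : HasZeroCoefficients p ω f) (hf : VanishingWeightsIn f S) :
    VanishingWeightsIn (fun a : Fin p × I => ω ^ (a.1 : ℕ) * f a.2) S := by
  intro x hx
  rw [sum_prod_twist] at hx
  rw [Fintype.sum_prod_type]
  refine S.sum_mem fun j _ => hf _ ?_
  simpa using hω (fun j i => x (j, i)) (by simpa using hx) j

theorem VanishingWeightsIn.prod_of_injective {I : Type*} [Fintype I] {p : ℕ} {ω : ℂ} {f : I → ℂ}
    {S : AddSubmonoid ℕ} (hω : HasEqualCoefficients p ω f)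
    (hf : ∀ x y : I → ℕ, ∑ i, (x i : ℂ) * f i = ∑ i, (y i : ℂ) * f i → x = y) (hp : p ∈ S) :
    VanishingWeightsIn (fun a : Fin p × I => ω ^ (a.1 : ℕ) * f a.2) S := by
  intro x hx
  rw [sum_prod_twist] at hx
  rw [Fintype.sum_prod_type]
  have heq := hω (fun j i => x (j, i)) (by simpa using hx)
  rcases Nat.eq_zero_or_pos p with rfl | hp0
  · simp
  have hsum : ∀ j : Fin p, ∑ i, x (j, i) = ∑ i, x (⟨0, hp0⟩, i) := fun j => by
    have := hf (fun i => x (j, i)) (fun i => x (⟨0, hp0⟩, i)) (by simpa using heq j ⟨0, hp0⟩)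
    exact Finset.sum_congr rfl fun i _ => congrFun this i
  rw [Finset.sum_congr rfl fun j _ => hsum j]
  simpa [mul_comm] using S.nsmul_mem hp (∑ i, x (⟨0, hp0⟩, i))

/-- All layers have the same value. If the lightest one lies below every other, subtracting it
leaves vanishing layers, and the removed part has weight a multiple of `p`. Otherwise rigidity makes
some layer so heavy that the total exceeds the Frobenius number of `q` and `r`, hence lies in `S`
anyway. -/
theorem VanishingWeightsIn.prod {I : Type*} [Fintype I] {p q r : ℕ} {ω : ℂ} {f : I → ℂ}
    {S : AddSubmonoid ℕ} (hω : HasEqualCoefficients p ω f) (hr : IsRigidBelow f q r)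
    (hf : VanishingWeightsIn f S) (hp : p ∈ S) (hq : q ∈ S) (hrS : r ∈ S) (hq1 : 1 < q)
    (hqr : q < r) (hrp : r ≤ p) (hcop : q.Coprime r) :
    VanishingWeightsIn (fun a : Fin p × I => ω ^ (a.1 : ℕ) * f a.2) S := by
  intro x hx
  by_contra hnot
  rw [sum_prod_twist] at hx
  rw [Fintype.sum_prod_type] at hnot
  have heq := hω (fun j i => x (j, i)) (by simpa using hx)
  simp only [Int.cast_natCast] at heq
  set X : Fin p → ℕ := fun j => ∑ i, x (j, i) with hX
  change ¬ ∑ j, X j ∈ S at hnot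
  have hsmall : ∑ j, X j ≤ q * r - q - r := by
    by_contra! hlt
    refine hnot (AddSubmonoid.closure_le.2 ?_
      ((frobeniusNumber_iff.1 (frobeniusNumber_pair hcop hq1 (hq1.trans hqr))).2 _ hlt))
    rintro _ (rfl | rfl) <;> assumption
  have hqr2 : q + r ≤ q * r := Nat.add_le_mul hq1 (by omega)
  have : Nonempty (Fin p) := ⟨⟨0, by omega⟩⟩
  obtain ⟨j₀, hj₀⟩ := Finite.exists_min X
  have hpt : p * X j₀ ≤ ∑ j, X j := by
    simpa using Finset.card_nsmul_le_sum Finset.univ X (X j₀) fun j _ => hj₀ j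
  have htq : X j₀ < q := by
    by_contra! h
    have := Nat.mul_le_mul hrp h
    rw [mul_comm r q] at this
    omega
  by_cases hall : ∀ k i, x (j₀, i) ≤ x (k, i)
  · apply hnot
    have hsplit : ∀ k, X k = (∑ i, (x (k, i) - x (j₀, i))) + X j₀ := fun k => by
      rw [hX, ← Finset.sum_add_distrib]
      exact Finset.sum_congr rfl fun i _ => (Nat.sub_add_cancel (hall k i)).symm
    rw [Finset.sum_congr rfl fun k _ => hsplit k, Finset.sum_add_distrib]
    refine S.add_mem (S.sum_mem fun k _ => hf _ ?_) ?_
    · rw [← sub_eq_zero.2 (heq k j₀), ← Finset.sum_sub_distrib]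
      exact Finset.sum_congr rfl fun i _ => by rw [Nat.cast_sub (hall k i)]; ring
    · simpa [mul_comm] using S.nsmul_mem hp (X j₀)
  · push Not at hall
    obtain ⟨k, i₀, hki⟩ := hall
    have hbig : (q - X j₀) * (r - 1) ≤ X k := by
      refine (hr (fun i => x (j₀, i)) (fun i => x (k, i)) (heq j₀ k) htq).resolve_left fun h => ?_
      have := h i₀
      simp only at this
      omega
    have hsum : X k + (p - 1) * X j₀ ≤ ∑ j, X j := by
      rw [← Finset.add_sum_erase _ _ (Finset.mem_univ k)]
      gcongr
      simpa using Finset.card_nsmul_le_sum (Finset.univ.erase k) X (X j₀) fun j _ => hj₀ j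
    generalize X j₀ = t at *
    generalize X k = u at *
    generalize ∑ j, X j = V at *
    rw [Nat.sub_sub] at hsmall
    zify [htq.le, (by omega : 1 ≤ r), (by omega : 1 ≤ p), hqr2] at hbig hsum hsmall
    -- The total is at least `(q - t)(r - 1) + (p - 1)t ≥ q(r - 1)`, which exceeds `qr - q - r`.
    have : ((r : ℤ) - 1) * t ≤ (p - 1) * t := mul_le_mul_of_nonneg_right (by omega) (by omega)
    nlinarith

/-! ### Linear relations over cyclotomic fields -/

open IntermediateField in
theorem totient_le_natDegree_minpoly_adjoin {m n : ℕ} {ζ ξ ω : ℂ} (hm : 0 < m) (hn : 0 < n)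
    (hζ : IsPrimitiveRoot ζ m) (hξ : IsPrimitiveRoot ξ n) (hω : IsIntegral ℚ ω)
    (hmem : ξ ∈ ℚ⟮ζ⟯⟮ω⟯) :
    n.totient ≤ m.totient * (minpoly ℚ⟮ζ⟯ ω).natDegree := by
  have hω' : IsIntegral ℚ⟮ζ⟯ ω := hω.tower_top
  have hζi : IsIntegral ℚ ζ := (hζ.isIntegral hm).tower_top
  have hξi : IsIntegral ℚ ξ := (hξ.isIntegral hn).tower_top
  have h1 : Module.finrank ℚ ℚ⟮ζ⟯ = m.totient := by
    rw [adjoin.finrank hζi, ← Polynomial.cyclotomic_eq_minpoly_rat hζ hm,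
      Polynomial.natDegree_cyclotomic]
  have h2 : Module.finrank ℚ ℚ⟮ξ⟯ = n.totient := by
    rw [adjoin.finrank hξi, ← Polynomial.cyclotomic_eq_minpoly_rat hξ hn,
      Polynomial.natDegree_cyclotomic]
  have : FiniteDimensional ℚ ℚ⟮ζ⟯ := adjoin.finiteDimensional hζi
  have : FiniteDimensional ℚ⟮ζ⟯ ℚ⟮ζ⟯⟮ω⟯ := adjoin.finiteDimensional hω'
  have : FiniteDimensional ℚ ℚ⟮ζ⟯⟮ω⟯ := FiniteDimensional.trans ℚ ℚ⟮ζ⟯ ℚ⟮ζ⟯⟮ω⟯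
  have hle : ℚ⟮ξ⟯ ≤ (ℚ⟮ζ⟯⟮ω⟯).restrictScalars ℚ := adjoin_simple_le_iff.2 hmem
  have : FiniteDimensional ℚ ((ℚ⟮ζ⟯⟮ω⟯).restrictScalars ℚ) := this
  have h3 := LinearMap.finrank_le_finrank_of_injective
    (f := (IntermediateField.inclusion hle).toLinearMap)
    (IntermediateField.inclusion hle).toRingHom.injective
  have h4 : Module.finrank ℚ ((ℚ⟮ζ⟯⟮ω⟯).restrictScalars ℚ) = Module.finrank ℚ ℚ⟮ζ⟯⟮ω⟯ := rfl
  rw [← h2, ← h1, ← adjoin.finrank hω', Module.finrank_mul_finrank ℚ ℚ⟮ζ⟯ ℚ⟮ζ⟯⟮ω⟯, ← h4]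
  exact h3

theorem eq_zero_of_sum_pow_eq_zero {K : IntermediateField ℚ ℂ} {ω : ℂ} {n : ℕ}
    (hn : n ≤ (minpoly K ω).natDegree) (α : Fin n → ℂ) (hα : ∀ j, α j ∈ K)
    (h : ∑ j : Fin n, ω ^ (j : ℕ) * α j = 0) (j : Fin n) : α j = 0 := by
  have hli := (linearIndependent_pow (K := K) ω).comp _ (Fin.castLE_injective hn)
  have := Fintype.linearIndependent_iff.1 hli (fun j => ⟨α j, hα j⟩) (by
    rw [← h]
    exact Finset.sum_congr rfl fun j _ => by
      simp [Algebra.smul_def, mul_comm]) j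
  simpa using congrArg Subtype.val this

theorem sum_intCast_mul_mem {I : Type*} [Fintype I] (K : IntermediateField ℚ ℂ) {f : I → ℂ}
    (hf : ∀ i, f i ∈ K) (c : I → ℤ) : ∑ i, (c i : ℂ) * f i ∈ K :=
  sum_mem fun i _ => mul_mem (intCast_mem K (c i)) (hf i)

-- For `p ∣ m` the totient of `p * m` is `p` times that of `m`, so `ω` has degree at least `p` over
-- `ℚ⟮ζ⟯` and its first `p` powers are independent.
open IntermediateField in
theorem hasZeroCoefficients_of_dvd {I : Type*} [Fintype I] {p m : ℕ} (hp : p.Prime) (hm : 0 < m)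
    (hpm : p ∣ m) {ζ ω : ℂ} (hζ : IsPrimitiveRoot ζ m) (hω : IsPrimitiveRoot ω (p * m))
    {f : I → ℂ} (hf : ∀ i, f i ∈ ℚ⟮ζ⟯) : HasZeroCoefficients p ω f := by
  intro c hc
  have hpm0 : 0 < p * m := Nat.mul_pos hp.pos hm
  have hdeg := totient_le_natDegree_minpoly_adjoin hm hpm0 hζ hω
    (hω.isIntegral hpm0).tower_top (mem_adjoin_simple_self _ ω)
  rw [Nat.totient_mul_of_prime_of_dvd hp hpm, mul_comm] at hdeg
  exact eq_zero_of_sum_pow_eq_zero (Nat.le_of_mul_le_mul_left hdeg (Nat.totient_pos.2 hm)) _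
    (fun j => sum_intCast_mul_mem _ hf (c j)) hc

-- Here the degree of `ω` is at least `p - 1`, so up to scaling the only relation is `1 + ω + ⋯ + ω
-- ^ (p - 1) = 0`; subtracting a multiple of it removes the last coefficient.
open IntermediateField in
theorem hasEqualCoefficients_of_not_dvd {I : Type*} [Fintype I] {p m : ℕ} (hp : p.Prime)
    (hm : 0 < m) (hpm : ¬ p ∣ m) {ζ ω : ℂ} (hζ : IsPrimitiveRoot ζ m) (hω : IsPrimitiveRoot ω p)
    {f : I → ℂ} (hf : ∀ i, f i ∈ ℚ⟮ζ⟯) : HasEqualCoefficients p ω f := by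
  intro c hc
  have hξ : IsPrimitiveRoot (ω * ζ) (p * m) := by
    have := (Commute.all ω ζ).orderOf_mul_eq_mul_orderOf_of_coprime
      (by rw [← hω.eq_orderOf, ← hζ.eq_orderOf]; exact (Nat.Prime.coprime_iff_not_dvd hp).2 hpm)
    rw [← hω.eq_orderOf, ← hζ.eq_orderOf] at this
    rw [← this]
    exact IsPrimitiveRoot.orderOf _
  have hdeg := totient_le_natDegree_minpoly_adjoin hm (Nat.mul_pos hp.pos hm) hζ hξ
    (hω.isIntegral hp.pos).tower_top
    (mul_mem (mem_adjoin_simple_self _ ω)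
      (IntermediateField.algebraMap_mem (ℚ⟮ζ⟯⟮ω⟯) (⟨ζ, mem_adjoin_simple_self ℚ ζ⟩ : ℚ⟮ζ⟯)))
  rw [Nat.totient_mul_of_prime_of_not_dvd hp hpm, mul_comm] at hdeg
  replace hdeg := Nat.le_of_mul_le_mul_left hdeg (Nat.totient_pos.2 hm)
  obtain ⟨n, rfl⟩ : ∃ n, p = n + 1 := ⟨p - 1, by have := hp.pos; omega⟩
  set α : Fin (n + 1) → ℂ := fun j => ∑ i, (c j i : ℂ) * f i with hα
  have hgeom := hω.geom_sum_eq_zero hp.one_lt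
  rw [Finset.sum_range, Fin.sum_univ_castSucc] at hgeom
  have hc' : ∑ j : Fin (n + 1), ω ^ (j : ℕ) * α j = 0 := hc
  rw [Fin.sum_univ_castSucc] at hc'
  have hmem : ∀ j, α j ∈ ℚ⟮ζ⟯ := fun j => sum_intCast_mul_mem _ hf (c j)
  have hlast : ∀ j : Fin n, α j.castSucc - α (Fin.last n) = 0 :=
    eq_zero_of_sum_pow_eq_zero (by simpa using hdeg) _ (fun j => sub_mem (hmem _) (hmem _)) (by
      simp only [mul_sub, Finset.sum_sub_distrib, ← Finset.sum_mul]
      simp only [Fin.val_castSucc] at hc' hgeom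
      linear_combination hc' - α (Fin.last n) * hgeom)
  have : ∀ j, α j = α (Fin.last n) := fun j => by
    induction j using Fin.lastCases with
    | last => rfl
    | cast j => exact sub_eq_zero.1 (hlast j)
  intro j k
  exact (this j).trans (this k).symm

theorem IsRigidBelow.of_equiv {I J : Type*} [Fintype I] [Fintype J] {f : I → ℂ} {g : J → ℂ}
    {q r : ℕ} (hf : IsRigidBelow f q r) (e : I ≃ J) (he : ∀ i, g (e i) = f i) :
    IsRigidBelow g q r := by
  intro x y hxy hx
  rw [← e.sum_comp, ← e.sum_comp (fun j => (y j : ℂ) * g j)] at hxy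
  rw [← e.sum_comp] at hx
  rw [← e.sum_comp, ← e.sum_comp y]
  simp only [he] at hxy
  rcases hf (fun i => x (e i)) (fun i => y (e i)) hxy hx with h | h
  · exact Or.inl fun j => by simpa using h (e.symm j)
  · exact Or.inr h

theorem VanishingWeightsIn.of_equiv {I J : Type*} [Fintype I] [Fintype J] {f : I → ℂ} {g : J → ℂ}
    {S : AddSubmonoid ℕ} (hf : VanishingWeightsIn f S) (e : I ≃ J) (he : ∀ i, g (e i) = f i) :
    VanishingWeightsIn g S := by
  intro x hx
  rw [← e.sum_comp] at hx
  rw [← e.sum_comp]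
  simp only [he] at hx
  exact hf _ hx

theorem VanishingWeightsIn.mono {I : Type*} [Fintype I] {f : I → ℂ} {S T : AddSubmonoid ℕ}
    (hf : VanishingWeightsIn f S) (hST : S ≤ T) : VanishingWeightsIn f T :=
  fun x hx => hST (hf x hx)

/-! ### Decomposing the `p * m`-th roots of unity into twists of the `m`-th roots -/

noncomputable instance (N : ℕ) [NeZero N] : Fintype (rootsOfUnity N ℂ) := Fintype.ofFinite _

/-- The inclusion of the `N`-th roots of unity in the complex numbers. -/
def rootVal (N : ℕ) (z : rootsOfUnity N ℂ) : ℂ := ((z : ℂˣ) : ℂ)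

theorem rootVal_pow {N : ℕ} (z : rootsOfUnity N ℂ) : rootVal N z ^ N = 1 := by
  have := z.2
  rw [mem_rootsOfUnity'] at this
  exact this

theorem rootVal_injective (N : ℕ) : Function.Injective (rootVal N) :=
  fun _ _ h => Subtype.ext (Units.ext h)

theorem exists_rootVal_eq {N : ℕ} [NeZero N] {z : ℂ} (hz : z ^ N = 1) :
    ∃ w : rootsOfUnity N ℂ, rootVal N w = z :=
  ⟨rootsOfUnity.mkOfPowEq z hz, by simp [rootVal]⟩

theorem rootVal_mem_adjoin {m : ℕ} [NeZero m] {ζ : ℂ} (hζ : IsPrimitiveRoot ζ m)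
    (z : rootsOfUnity m ℂ) : rootVal m z ∈ IntermediateField.adjoin ℚ {ζ} := by
  obtain ⟨i, -, hi⟩ := hζ.eq_pow_of_pow_eq_one (rootVal_pow z)
  rw [← hi]
  exact pow_mem (IntermediateField.mem_adjoin_simple_self ℚ ζ) i

theorem exists_equiv_rootsOfUnity_mul {p m : ℕ} [NeZero m] [NeZero (p * m)] {ω : ℂ}
    (hω : ω ^ (p * m) = 1) (hdvd : ∀ i, ω ^ (i * m) = 1 → p ∣ i) :
    ∃ e : Fin p × rootsOfUnity m ℂ ≃ rootsOfUnity (p * m) ℂ,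
      ∀ a, rootVal (p * m) (e a) = ω ^ (a.1 : ℕ) * rootVal m a.2 := by
  have hω0 : ω ≠ 0 := by
    rintro rfl
    exact zero_ne_one ((zero_pow (NeZero.ne _)).symm.trans hω)
  have hpow : ∀ a : Fin p × rootsOfUnity m ℂ,
      (ω ^ (a.1 : ℕ) * rootVal m a.2) ^ (p * m) = 1 := fun a => by
    rw [mul_pow, ← pow_mul, mul_comm (a.1 : ℕ), pow_mul, hω, one_pow, one_mul, mul_comm p, pow_mul,
      rootVal_pow, one_pow]
  choose F hF using fun a => exists_rootVal_eq (hpow a)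
  -- Raising to the power `m` kills the `m`-th roots and leaves a relation between powers of `ω`.
  have hle : ∀ a b, F a = F b → (a.1 : ℕ) ≤ b.1 → a = b := by
    rintro ⟨j, z⟩ ⟨k, w⟩ hab hjk
    have h := congrArg (rootVal (p * m)) hab
    rw [hF, hF] at h
    simp only at h hjk
    have hm := congrArg (· ^ m) h
    simp only [mul_pow, rootVal_pow, mul_one] at hm
    have h1 : ω ^ ((k - j : ℕ) * m) = 1 := by
      have : ω ^ ((j : ℕ) * m) * ω ^ ((k - j : ℕ) * m) = ω ^ ((j : ℕ) * m) * 1 := by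
        rw [← pow_add, ← add_mul, Nat.add_sub_cancel' hjk, mul_one, pow_mul, pow_mul, hm]
      exact mul_left_cancel₀ (pow_ne_zero _ hω0) this
    have h2 := Nat.eq_zero_of_dvd_of_lt (hdvd _ h1) (by omega)
    have h3 : j = k := Fin.ext (by omega)
    subst h3
    rw [rootVal_injective m (mul_left_cancel₀ (pow_ne_zero _ hω0) h)]
  have hinj : Function.Injective F := fun a b hab => by
    rcases le_total (a.1 : ℕ) b.1 with h | h
    · exact hle a b hab h
    · exact (hle b a hab.symm h).symm
  refine ⟨Equiv.ofBijective F ((Fintype.bijective_iff_injective_and_card F).2 ⟨hinj, ?_⟩), hF⟩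
  rw [← Nat.card_eq_fintype_card, ← Nat.card_eq_fintype_card, Nat.card_prod,
    Complex.card_rootsOfUnity, Complex.card_rootsOfUnity, Nat.card_fin]

theorem exists_equiv_rootsOfUnity_of_dvd {p m : ℕ} [NeZero m] [NeZero (p * m)] (hp : p.Prime)
    (hpm : p ∣ m) : ∃ ω : ℂ, HasZeroCoefficients p ω (rootVal m) ∧
      ∃ e : Fin p × rootsOfUnity m ℂ ≃ rootsOfUnity (p * m) ℂ,
        ∀ a, rootVal (p * m) (e a) = ω ^ (a.1 : ℕ) * rootVal m a.2 := by
  have hω := Complex.isPrimitiveRoot_exp (p * m) (NeZero.ne _)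
  have hζ := Complex.isPrimitiveRoot_exp m (NeZero.ne _)
  refine ⟨_, hasZeroCoefficients_of_dvd hp (NeZero.pos m) hpm hζ hω (rootVal_mem_adjoin hζ),
    exists_equiv_rootsOfUnity_mul hω.pow_eq_one fun i hi => ?_⟩
  exact Nat.dvd_of_mul_dvd_mul_right (NeZero.pos m) (hω.dvd_of_pow_eq_one _ hi)

theorem exists_equiv_rootsOfUnity_of_not_dvd {p m : ℕ} [NeZero m] [NeZero (p * m)] (hp : p.Prime)
    (hpm : ¬ p ∣ m) : ∃ ω : ℂ, HasEqualCoefficients p ω (rootVal m) ∧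
      ∃ e : Fin p × rootsOfUnity m ℂ ≃ rootsOfUnity (p * m) ℂ,
        ∀ a, rootVal (p * m) (e a) = ω ^ (a.1 : ℕ) * rootVal m a.2 := by
  have hω := Complex.isPrimitiveRoot_exp p hp.ne_zero
  have hζ := Complex.isPrimitiveRoot_exp m (NeZero.ne _)
  refine ⟨_, hasEqualCoefficients_of_not_dvd hp (NeZero.pos m) hpm hζ hω (rootVal_mem_adjoin hζ),
    exists_equiv_rootsOfUnity_mul (by rw [pow_mul, hω.pow_eq_one, one_pow]) fun i hi => ?_⟩
  exact (hp.dvd_mul.1 (hω.dvd_of_pow_eq_one _ hi)).resolve_right hpm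

theorem rootVal_one_combination_injective (x y : rootsOfUnity 1 ℂ → ℕ)
    (h : ∑ i, (x i : ℂ) * rootVal 1 i = ∑ i, (y i : ℂ) * rootVal 1 i) : x = y := by
  have hval : ∀ z, rootVal 1 z = 1 := fun z => by simpa using rootVal_pow z
  have hsub : ∀ z w : rootsOfUnity 1 ℂ, z = w := fun z w =>
    rootVal_injective 1 ((hval z).trans (hval w).symm)
  have hsum : ∀ g : rootsOfUnity 1 ℂ → ℂ, ∑ i, g i = g 1 := fun g =>
    Fintype.sum_eq_single 1 fun z hz => absurd (hsub z 1) hz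
  rw [hsum, hsum, hval, mul_one, mul_one, Nat.cast_inj] at h
  funext z
  rw [hsub z 1, h]

/-! ### Rigidity and the Lam–Leung theorem by induction on the primes -/

/-- Induction on a positive integer by adjoining its prime factors in increasing order. -/
theorem Nat.induction_on_largest_prime {P : ℕ → Prop} (one : P 1)
    (step : ∀ p m : ℕ, p.Prime → 0 < m → (∀ q : ℕ, q.Prime → q ∣ m → q ≤ p) → P m → P (p * m))
    (N : ℕ) (hN : 0 < N) : P N := by
  induction N using Nat.strong_induction_on with
  | _ N ih =>
    rcases eq_or_ne N 1 with rfl | h1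
    · exact one
    obtain ⟨p, hp, hmax⟩ := N.primeFactors.exists_max_image id (Nat.nonempty_primeFactors.2 (by omega))
    have hpp := Nat.prime_of_mem_primeFactors hp
    obtain ⟨m, rfl⟩ := Nat.dvd_of_mem_primeFactors hp
    have hm : 0 < m := Nat.pos_of_mul_pos_left hN
    refine step p m hpp hm (fun q hq hqm => hmax q ?_) (ih m ?_ hm)
    · exact Nat.mem_primeFactors.2 ⟨hq, hqm.mul_left p, hN.ne'⟩
    · exact lt_mul_of_one_lt_left hm hpp.one_lt

theorem isRigidBelow_rootVal {q r : ℕ} (hq : 1 ≤ q) (hqr : q ≤ r) (N : ℕ) [NeZero N]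
    (hN : ∀ p : ℕ, p.Prime → p ∣ N → p = q ∨ r ≤ p) : IsRigidBelow (rootVal N) q r := by
  refine Nat.induction_on_largest_prime (P := fun N => ∀ [NeZero N],
    (∀ p : ℕ, p.Prime → p ∣ N → p = q ∨ r ≤ p) → IsRigidBelow (rootVal N) q r) ?_ ?_ N
    (NeZero.pos N) hN
  · intro _ _ x y hxy _
    exact Or.inl (rootVal_one_combination_injective x y hxy).le
  · intro p m hp hm hmax ih _ hN
    have : NeZero m := ⟨hm.ne'⟩
    have hNm : ∀ l : ℕ, l.Prime → l ∣ m → l = q ∨ r ≤ l := fun l hl h => hN l hl (h.mul_left p)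
    by_cases hpm : p ∣ m
    · obtain ⟨ω, hω, e, he⟩ := exists_equiv_rootsOfUnity_of_dvd hp hpm
      exact ((ih hNm).prod_of_independent hω).of_equiv e he
    obtain ⟨ω, hω, e, he⟩ := exists_equiv_rootsOfUnity_of_not_dvd hp hpm
    rcases le_or_gt r p with h | h
    · exact ((ih hNm).prod hω hq hqr h).of_equiv e he
    -- A largest prime below `r` must be `q`; since it does not divide `m`, nothing else remains and
    -- `m = 1`.
    · have hpq : p = q := (hN p hp (dvd_mul_right p m)).resolve_right (by omega)
      have hm1 : m = 1 := by
        by_contra hm1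
        obtain ⟨l, hl, hlm⟩ := Nat.exists_prime_and_dvd hm1
        have h1 := hmax l hl hlm
        rcases hNm l hl hlm with h2 | h2
        · exact hpm (by rwa [hpq, ← h2])
        · omega
      subst hm1
      exact (IsRigidBelow.prod_of_injective hω rootVal_one_combination_injective hpq.ge r).of_equiv
        e he

/-- **Lam–Leung**: the length of a vanishing sum of `N`-th roots of unity is a natural combination
of the prime factors of `N`. -/
theorem vanishingWeightsIn_rootVal (N : ℕ) [NeZero N] :
    VanishingWeightsIn (rootVal N) (AddSubmonoid.closure (N.primeFactors : Set ℕ)) := by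
  refine Nat.induction_on_largest_prime (P := fun N => ∀ [NeZero N], VanishingWeightsIn (rootVal N)
    (AddSubmonoid.closure (N.primeFactors : Set ℕ))) ?_ ?_ N (NeZero.pos N)
  · intro _ x hx
    have := rootVal_one_combination_injective x 0 (by simpa using hx)
    simp [this]
  · intro p m hp hm hmax ih _
    have : NeZero m := ⟨hm.ne'⟩
    have hpm0 : p * m ≠ 0 := NeZero.ne _
    set S := AddSubmonoid.closure ((p * m).primeFactors : Set ℕ)
    have hS : ∀ l : ℕ, l ∈ (p * m).primeFactors → l ∈ S := fun l hl =>
      AddSubmonoid.subset_closure hl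
    have hpN : p ∈ (p * m).primeFactors := Nat.mem_primeFactors.2 ⟨hp, dvd_mul_right p m, hpm0⟩
    have ihS : VanishingWeightsIn (rootVal m) S := ih.mono (AddSubmonoid.closure_mono (by
      exact_mod_cast Nat.primeFactors_mono (dvd_mul_left m p) hpm0))
    by_cases hpm : p ∣ m
    · obtain ⟨ω, hω, e, he⟩ := exists_equiv_rootsOfUnity_of_dvd hp hpm
      exact (ihS.prod_of_independent hω).of_equiv e he
    obtain ⟨ω, hω, e, he⟩ := exists_equiv_rootsOfUnity_of_not_dvd hp hpm
    rcases eq_or_ne m 1 with rfl | hm1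
    · exact (VanishingWeightsIn.prod_of_injective hω rootVal_one_combination_injective
        (hS p hpN)).of_equiv e he
    have hq := Nat.minFac_prime hm1
    have hqm := Nat.minFac_dvd m
    have hqp : m.minFac ≠ p := fun h => hpm (h ▸ hqm)
    -- `q = m.minFac` and `r` are the two smallest primes of `p * m`, so every prime factor of `m`
    -- is `q` or at least `r`, as rigidity requires.
    obtain ⟨r, hr, hrmin⟩ := ((p * m).primeFactors.erase m.minFac).exists_min_image id
      ⟨p, Finset.mem_erase.2 ⟨hqp.symm, hpN⟩⟩
    obtain ⟨hrq, hrN⟩ := Finset.mem_erase.1 hr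
    have hrp := Nat.prime_of_mem_primeFactors hrN
    have hqr : m.minFac < r := by
      rcases hrp.dvd_mul.1 (Nat.dvd_of_mem_primeFactors hrN) with h | h
      · rw [(Nat.prime_dvd_prime_iff_eq hrp hp).1 h]
        exact lt_of_le_of_ne (hmax _ hq hqm) hqp
      · exact lt_of_le_of_ne (Nat.minFac_le_of_dvd hrp.two_le h) hrq.symm
    refine (ihS.prod hω (isRigidBelow_rootVal hq.one_lt.le hqr.le m fun l hl hlm => ?_) (hS p hpN)
      (hS _ (Nat.mem_primeFactors.2 ⟨hq, hqm.mul_left p, hpm0⟩)) (hS r hrN) hq.one_lt hqr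
      (hrmin p (Finset.mem_erase.2 ⟨hqp.symm, hpN⟩))
      ((Nat.coprime_primes hq hrp).2 hrq.symm)).of_equiv e he
    by_cases h : l = m.minFac
    · exact Or.inl h
    · exact Or.inr (hrmin l (Finset.mem_erase.2
        ⟨h, Nat.mem_primeFactors.2 ⟨hl, hlm.mul_left p, hpm0⟩⟩))

/-! ### The kernel of the adjacency matrix -/

theorem discreteTorus_adj_iff {d N : ℕ} [NeZero N] (hN : 3 ≤ N) (u v : Fin d → ZMod N) :
    (discreteTorus d N).Adj u v ↔
      ∃ i : Fin d, v = u + Pi.single i 1 ∨ v = u + -Pi.single i 1 := by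
  have : Fact (1 < N) := ⟨by omega⟩
  rw [discreteTorus, SimpleGraph.addCayley_adj']
  constructor
  · rintro ⟨-, g, ⟨i, rfl | rfl⟩, h | h⟩
    · exact ⟨i, Or.inl h.symm⟩
    · exact ⟨i, Or.inr (by rw [h]; abel)⟩
    · exact ⟨i, Or.inr h.symm⟩
    · exact ⟨i, Or.inl (by rw [h]; abel)⟩
  · rintro ⟨i, rfl | rfl⟩
    · refine ⟨fun h => ?_, Pi.single i 1, ⟨i, Or.inl rfl⟩, Or.inl rfl⟩
      simpa using congrFun (left_eq_add.1 h) i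
    · refine ⟨fun h => ?_, -Pi.single i 1, ⟨i, Or.inr rfl⟩, Or.inl rfl⟩
      simpa using congrFun (left_eq_add.1 h) i

open Classical in
theorem discreteTorus_adjMatrix_mulVec {d N : ℕ} [NeZero N] (hN : 3 ≤ N)
    (f : (Fin d → ZMod N) → ℝ) (u : Fin d → ZMod N) :
    ((discreteTorus d N).adjMatrix ℝ).mulVec f u =
      ∑ i : Fin d, (f (u + Pi.single i 1) + f (u + -Pi.single i 1)) := by
  have : Fact (1 < N) := ⟨by omega⟩
  -- This makes the `2d` translates `u ± e_i` distinct, so each neighbour is counted once.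
  have h2 : (1 : ZMod N) ≠ -1 := fun h => by
    have h' : ((2 : ℕ) : ZMod N) = 0 := by
      push_cast
      linear_combination h
    have := Nat.le_of_dvd (by norm_num) ((ZMod.natCast_eq_zero_iff _ _).1 h')
    omega
  set g : Fin d ⊕ Fin d → (Fin d → ZMod N) :=
    Sum.elim (fun i => u + Pi.single i 1) (fun i => u + -Pi.single i 1) with hg
  have hsingle : ∀ {i j : Fin d} {a b : ZMod N}, a ≠ 0 →
      (Pi.single i a : Fin d → ZMod N) = Pi.single j b → i = j ∧ a = b := by
    intro i j a b ha h
    have h1 := congrFun h i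
    rw [Pi.single_eq_same] at h1
    by_cases hij : i = j
    · subst hij
      rw [Pi.single_eq_same] at h1
      exact ⟨rfl, h1⟩
    · rw [Pi.single_eq_of_ne hij] at h1
      exact absurd h1 ha
  have hginj : Function.Injective g := by
    rintro (i | i) (j | j) h <;>
      simp only [hg, Sum.elim_inl, Sum.elim_inr, add_right_inj, ← Pi.single_neg] at h
    · rw [(hsingle one_ne_zero h).1]
    · exact absurd (hsingle one_ne_zero h).2 h2
    · exact absurd (hsingle (neg_ne_zero.2 one_ne_zero) h).2 h2.symm
    · rw [(hsingle (neg_ne_zero.2 one_ne_zero) h).1]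
  have hnb : (discreteTorus d N).neighborFinset u = Finset.univ.image g := by
    ext v
    simp [discreteTorus_adj_iff hN, hg, eq_comm, exists_or]
  rw [SimpleGraph.adjMatrix_mulVec_apply, hnb, Finset.sum_image hginj.injOn,
    Fintype.sum_sum_type, Finset.sum_add_distrib]
  rfl

theorem isGraphEigenvalue_zero_iff {d N : ℕ} [NeZero N] (hN : 3 ≤ N) :
    IsGraphEigenvalue (discreteTorus d N) 0 ↔ ∃ f : (Fin d → ZMod N) → ℝ, f ≠ 0 ∧
      ∀ u : Fin d → ZMod N, ∑ i : Fin d, (f (u + Pi.single i 1) + f (u + -Pi.single i 1)) = 0 := by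
  rw [IsGraphEigenvalue, Module.End.hasEigenvalue_iff, Submodule.ne_bot_iff]
  simp only [Module.End.mem_eigenspace_iff, Matrix.toLin'_apply, zero_smul, funext_iff,
    discreteTorus_adjMatrix_mulVec hN, Pi.zero_apply, ne_eq]
  exact exists_congr fun f => and_comm

/-- Fourier analysis on the discrete torus: `0` is an eigenvalue if and only if it is the value at
some character of the sum of the generators. -/
theorem isGraphEigenvalue_zero_iff_exists_roots {d N : ℕ} [NeZero N] (hN : 3 ≤ N) :
    IsGraphEigenvalue (discreteTorus d N) 0 ↔
      ∃ z : Fin d → ℂ, (∀ i, z i ^ N = 1) ∧ ∑ i, (z i + (z i)⁻¹) = 0 := by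
  rw [isGraphEigenvalue_zero_iff hN]
  constructor
  · rintro ⟨f, hf0, hf⟩
    -- By Fourier inversion a nonzero function has a nonzero Fourier coefficient.
    obtain ⟨ψ, hψ⟩ : ∃ ψ : AddChar (Fin d → ZMod N) ℂ, ∑ u, (f u : ℂ) * ψ u ≠ 0 := by
      by_contra! hall
      refine hf0 (funext fun v => ?_)
      have h1 : ∑ ψ : AddChar (Fin d → ZMod N) ℂ, ∑ u, (f u : ℂ) * ψ u * ψ (-v) = 0 :=
        Finset.sum_eq_zero fun ψ _ => by rw [← Finset.sum_mul, hall, zero_mul]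
      rw [Finset.sum_comm] at h1
      simp only [mul_assoc, ← AddChar.map_add_eq_mul, ← Finset.mul_sum,
        AddChar.sum_apply_eq_ite, add_neg_eq_zero, mul_ite, mul_zero] at h1
      simpa [-Fintype.card_pi, Fintype.card_ne_zero] using h1
    have hψN : ∀ i, ψ (Pi.single i 1) ^ N = 1 := fun i => by
      rw [← AddChar.map_nsmul_eq_pow, ← Pi.single_smul]
      simp
    refine ⟨fun i => ψ (Pi.single i 1), hψN, (mul_eq_zero.1 ?_).resolve_left hψ⟩
    have hshift : ∀ w, ∑ u, (f (u + w) : ℂ) * ψ u = (∑ u, (f u : ℂ) * ψ u) * ψ (-w) := fun w => by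
      rw [Finset.sum_mul, ← Equiv.sum_comp (Equiv.addRight w) (fun u => (f u : ℂ) * ψ u * ψ (-w))]
      refine Finset.sum_congr rfl fun u _ => ?_
      simp [mul_assoc, ← AddChar.map_add_eq_mul]
    have h2 : ∑ u, (∑ i : Fin d, ((f (u + Pi.single i 1) : ℂ) + f (u + -Pi.single i 1))) * ψ u
        = 0 := Finset.sum_eq_zero fun u _ => by
      have := congrArg (fun r : ℝ => (r : ℂ)) (hf u)
      push_cast at this
      rw [this, zero_mul]
    simp only [Finset.sum_mul] at h2
    rw [Finset.sum_comm] at h2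
    rw [Finset.mul_sum, ← h2]
    refine Finset.sum_congr rfl fun i _ => ?_
    simp only [add_mul, Finset.sum_add_distrib, hshift, neg_neg]
    rw [AddChar.map_neg_eq_inv]
    ring
  · rintro ⟨z, hz, hsum⟩
    set F : (Fin d → ZMod N) → ℂ := fun u => ∏ i, AddChar.zmodChar N (hz i) (u i) with hF
    have hF0 : F 0 = 1 := by simp [hF]
    have hchar1 : ∀ i, AddChar.zmodChar N (hz i) 1 = z i := fun i => by
      simpa using AddChar.zmodChar_apply' (hz i) 1
    have hadd : ∀ u v, F (u + v) = F u * F v := fun u v => by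
      simp [hF, AddChar.map_add_eq_mul, Finset.prod_mul_distrib]
    have hF1 : ∀ i, F (Pi.single i 1) = z i := fun i => by
      rw [hF]
      simp only
      rw [Fintype.prod_eq_single i fun j hj => by rw [Pi.single_eq_of_ne hj, AddChar.map_zero_eq_one],
        Pi.single_eq_same, hchar1]
    have hFneg : ∀ i, F (-Pi.single i 1) = (z i)⁻¹ := fun i => by
      refine eq_inv_of_mul_eq_one_left ?_
      rw [← hF1, ← hadd, neg_add_cancel, hF0]
    -- The real part of a complex kernel vector is again in the kernel, and here it equals `1` at
    -- the origin.
    refine ⟨fun u => (F u).re, fun h => ?_, fun u => ?_⟩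
    · have := congrFun h 0
      simp [hF0] at this
    · simp only [← Complex.add_re, ← Complex.re_sum, hadd, hF1, hFneg, ← mul_add]
      rw [← Finset.mul_sum, hsum, mul_zero, Complex.zero_re]

/-! ### Building vanishing sums -/

theorem exists_fin_of_multiset {N d : ℕ} (s : Multiset ℂ) (hcard : Multiset.card s = d)
    (hs : ∀ z ∈ s, z ^ N = 1) (hsum : (s.map fun z => z + z⁻¹).sum = 0) :
    ∃ z : Fin d → ℂ, (∀ i, z i ^ N = 1) ∧ ∑ i, (z i + (z i)⁻¹) = 0 := by
  subst hcard
  obtain ⟨l, rfl⟩ := Quot.exists_rep s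
  refine ⟨fun i : Fin l.length => l[i.1], fun i => hs _ (List.getElem_mem i.2), ?_⟩
  exact (Fin.sum_univ_fun_getElem l fun z => z + z⁻¹).trans hsum

/-- One representative of each pair `{z, z⁻¹}` of non-trivial `p`-th roots of unity. -/
theorem exists_half_polygon {p N : ℕ} (hp : Odd p) (hp1 : p ≠ 1) (hpN : p ∣ N) :
    ∃ s : Multiset ℂ, (∀ z ∈ s, z ^ N = 1) ∧ 2 * Multiset.card s + 1 = p ∧
      (s.map fun z => z + z⁻¹).sum = -1 := by
  obtain ⟨k, rfl⟩ := hp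
  have hω := Complex.isPrimitiveRoot_exp (2 * k + 1) (by omega)
  generalize Complex.exp (2 * Real.pi * Complex.I / (2 * k + 1 : ℕ)) = ω at hω
  refine ⟨(Multiset.range k).map fun j => ω ^ (j + 1), fun z hz => ?_, by simp, ?_⟩
  · obtain ⟨j, -, rfl⟩ := Multiset.mem_map.1 hz
    obtain ⟨m, rfl⟩ := hpN
    rw [← pow_mul, mul_comm, mul_assoc, pow_mul, hω.pow_eq_one, one_pow]
  · rw [Multiset.map_map]
    change ∑ j ∈ Finset.range k, (ω ^ (j + 1) + (ω ^ (j + 1))⁻¹) = -1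
    -- The inverses of the first `k` nontrivial powers are the last `k` powers in reverse order.
    have hinv : ∀ j ∈ Finset.range k, (ω ^ (j + 1))⁻¹ = ω ^ (k + (k - 1 - j) + 1) := fun j hj => by
      refine inv_eq_of_mul_eq_one_right ?_
      rw [← pow_add, ← hω.pow_eq_one]
      congr 1
      have := Finset.mem_range.1 hj
      omega
    have hgeom := hω.geom_sum_eq_zero (by omega)
    rw [Finset.sum_range_succ', two_mul, Finset.sum_range_add, pow_zero] at hgeom
    rw [Finset.sum_add_distrib, Finset.sum_congr rfl hinv,
      Finset.sum_range_reflect (fun j => ω ^ (k + j + 1))]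
    linear_combination hgeom

/-! ### Obstructions to vanishing sums -/

theorem exists_weights {T : Type*} [Fintype T] {N : ℕ} [NeZero N] (w : T → ℂ)
    (hw : ∀ t, w t ^ N = 1) :
    ∃ x : rootsOfUnity N ℂ → ℕ, ∑ i, (x i : ℂ) * rootVal N i = ∑ t, w t ∧
      ∑ i, x i = Fintype.card T := by
  classical
  choose g hg using fun t => exists_rootVal_eq (hw t)
  refine ⟨fun i => (Finset.univ.filter fun t => g t = i).card, ?_, ?_⟩
  · rw [← Finset.sum_fiberwise Finset.univ g]
    refine Finset.sum_congr rfl fun i _ => ?_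
    rw [← nsmul_eq_mul, ← Finset.sum_const]
    refine Finset.sum_congr rfl fun t ht => ?_
    rw [← (Finset.mem_filter.1 ht).2, hg]
  · exact (Finset.card_eq_sum_card_fiberwise fun t _ => Finset.mem_univ (g t)).symm

theorem exists_symmetric_weights {T : Type*} [Fintype T] {N : ℕ} [NeZero N] (w : T → ℂ)
    (hw : ∀ t, w t ^ N = 1) :
    ∃ x : rootsOfUnity N ℂ → ℕ, ∑ i, (x i : ℂ) * rootVal N i = ∑ t, (w t + (w t)⁻¹) ∧
      ∑ i, x i = 2 * Fintype.card T := by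
  obtain ⟨x, h1, h2⟩ := exists_weights (N := N) (Sum.elim w fun t => (w t)⁻¹) (by
    rintro (t | t)
    · exact hw t
    · simp [hw t])
  refine ⟨x, ?_, ?_⟩
  · rw [h1, Fintype.sum_sum_type, Finset.sum_add_distrib]
    rfl
  · rw [h2, Fintype.card_sum, two_mul]

/-- Rigidity leaves two options. If `u ≤ v`, then `v - u` vanishes with a positive even weight at
most `2d`, whereas a nonzero even sum of odd primes above `d` has at least two terms and exceeds
`2d`. Otherwise `v` would weigh more than `2d`. -/
theorem not_balanced_of_lt {M d α β : ℕ} [NeZero M] (hd : Odd d)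
    (hM : ∀ l : ℕ, l.Prime → l ∣ M → Odd l ∧ d < l) (hαβ : α + β = d)
    (u v : rootsOfUnity M ℂ → ℕ) (hu : ∑ i, u i = 2 * α) (hv : ∑ i, v i = 2 * β)
    (huv : ∑ i, (u i : ℂ) * rootVal M i = ∑ i, (v i : ℂ) * rootVal M i) : ¬ α < β := by
  intro hlt
  obtain ⟨k, rfl⟩ := hd
  have hM' : ∀ l : ℕ, l.Prime → l ∣ M → Odd l ∧ 2 * k + 3 ≤ l := fun l hl hlM => by
    obtain ⟨⟨m, rfl⟩, h⟩ := hM l hl hlM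
    exact ⟨⟨m, rfl⟩, by omega⟩
  -- Odd primes above `d = 2k + 1` are at least `d + 2 = 2k + 3`.
  rcases isRigidBelow_rootVal (q := 2 * k + 3) (r := 2 * k + 3) (by omega) le_rfl M
    (fun l hl hlM => Or.inr (hM' l hl hlM).2) u v huv (by omega) with hle | hbig
  · have hmem := vanishingWeightsIn_rootVal M (fun i => v i - u i) (by
      rw [← sub_eq_zero.2 huv.symm, ← Finset.sum_sub_distrib]
      exact Finset.sum_congr rfl fun i _ => by rw [Nat.cast_sub (hle i)]; ring)
    have hsum : ∑ i, (v i - u i) + ∑ i, u i = ∑ i, v i := by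
      rw [← Finset.sum_add_distrib]
      exact Finset.sum_congr rfl fun i _ => Nat.sub_add_cancel (hle i)
    have hcl : ∀ n ∈ AddSubmonoid.closure (M.primeFactors : Set ℕ),
        n = 0 ∨ (n % 2 = 1 ∧ 2 * k + 3 ≤ n) ∨ 2 * (2 * k + 3) ≤ n := by
      intro n hn
      induction hn using AddSubmonoid.closure_induction with
      | mem l hl =>
        have hl' := Nat.mem_primeFactors.1 (Finset.mem_coe.1 hl)
        obtain ⟨h1, h2⟩ := hM' l hl'.1 hl'.2.1
        exact Or.inr (Or.inl ⟨Nat.odd_iff.1 h1, h2⟩)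
      | zero => exact Or.inl rfl
      | add a b _ _ ha hb => omega
    have := hcl _ hmem
    omega
  · rw [hu, hv] at hbig
    -- As `α < β` and `α + β = 2k + 1`, one has `2α ≤ 2k`, which leaves a gap of at least `3`.
    have h3 : 3 * (2 * k + 3 - 1) ≤ (2 * k + 3 - 2 * α) * (2 * k + 3 - 1) :=
      Nat.mul_le_mul_right _ (by omega)
    omega

/-- There are no vanishing sums of an odd number `d` of pairs `z + z⁻¹` of `2 M`-th roots of unity
when `M` is odd with all prime factors larger than `d`. -/
theorem sum_add_inv_ne_zero {M d : ℕ} [NeZero M] (hd : Odd d)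
    (hM : ∀ l : ℕ, l.Prime → l ∣ M → Odd l ∧ d < l) (hMo : Odd M) (z : Fin d → ℂ)
    (hz : ∀ i, z i ^ (2 * M) = 1) : ∑ i, (z i + (z i)⁻¹) ≠ 0 := by
  classical
  intro hsum
  obtain ⟨u, hu1, hu2⟩ := exists_symmetric_weights (N := M)
    (fun i : {i // z i ^ M = 1} => z i) fun i => i.2
  obtain ⟨v, hv1, hv2⟩ := exists_symmetric_weights (N := M)
    (fun i : {i // ¬ z i ^ M = 1} => -z i) fun i => by
      have h1 : z i ^ M = -1 := (sq_eq_one_iff.1 (by rw [← pow_mul', hz])).resolve_left i.2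
      rw [hMo.neg_pow, h1, neg_neg]
  have hcard : Fintype.card {i // z i ^ M = 1} + Fintype.card {i // ¬ z i ^ M = 1} = d := by
    rw [Fintype.card_subtype_compl, Nat.add_sub_cancel' (Fintype.card_subtype_le _),
      Fintype.card_fin]
  have huv : ∑ i, (u i : ℂ) * rootVal M i = ∑ i, (v i : ℂ) * rootVal M i := by
    rw [hu1, hv1, ← sub_eq_zero, ← hsum,
      ← Fintype.sum_subtype_add_sum_subtype (fun i => z i ^ M = 1), sub_eq_add_neg,
      ← Finset.sum_neg_distrib]
    congr 1
    exact Finset.sum_congr rfl fun i _ => by rw [inv_neg]; ring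
  have h1 := not_balanced_of_lt hd hM hcard u v hu2 hv2 huv
  have h2 := not_balanced_of_lt hd hM ((add_comm _ _).trans hcard) v u hv2 hu2 huv.symm
  obtain ⟨k, rfl⟩ := hd
  omega

/-! ### The four cases -/

theorem proposition4p1 (d N s : ℕ) [NeZero N] (hd : 1 ≤ d) (hN : 3 ≤ N)
    (p a : Fin s → ℕ) (hp : ∀ i, (p i).Prime) (hmono : StrictMono p) (ha : ∀ i, 1 ≤ a i)
    (hfact : N = ∏ i, p i ^ a i) :
    -- (i)
    (¬ 2 ∣ N →
      (IsGraphEigenvalue (discreteTorus d N) 0 ↔ ∃ b : Fin s → ℕ, 2 * d = ∑ i, b i * p i)) ∧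
    -- (ii)
    (2 ∣ N → Even d → IsGraphEigenvalue (discreteTorus d N) 0) ∧
    -- (iii); `p ⟨1, h⟩` is the second smallest prime factor
    (2 ∣ N → Odd d → (∃ h : 1 < s, p ⟨1, h⟩ ≤ d) →
      IsGraphEigenvalue (discreteTorus d N) 0) ∧
    -- (iv); the condition on the second prime factor holds if there is none
    (2 ∣ N → Odd d → (∀ h : 1 < s, d < p ⟨1, h⟩) →
      (IsGraphEigenvalue (discreteTorus d N) 0 ↔ 4 ∣ N)) := by
  rw [isGraphEigenvalue_zero_iff_exists_roots hN]
  have hdvd : ∀ i, p i ∣ N := fun i =>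
    hfact ▸ (dvd_pow_self (p i) (by have := ha i; omega)).trans
      (Finset.dvd_prod_of_mem (fun i => p i ^ a i) (Finset.mem_univ i))
  have hfactor : ∀ l : ℕ, l.Prime → l ∣ N → ∃ i, l = p i := fun l hl hlN => by
    rw [hfact] at hlN
    obtain ⟨i, -, hi⟩ := (Nat.Prime.prime hl).exists_mem_finset_dvd hlN
    exact ⟨i, (Nat.prime_dvd_prime_iff_eq hl (hp i)).1 (hl.dvd_of_dvd_pow hi)⟩
  have hpairs : ∀ k, 2 ∣ N → ∀ z ∈ Multiset.replicate k (1 : ℂ) + Multiset.replicate k (-1),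
      z ^ N = 1 := fun k h2 z hz => by
    rcases Multiset.mem_add.1 hz with h | h <;> rw [Multiset.eq_of_mem_replicate h]
    · exact one_pow N
    · exact (even_iff_two_dvd.2 h2).neg_one_pow
  refine ⟨fun h2 => ⟨?_, ?_⟩, fun h2 hde => ?_, fun h2 hdo ⟨h1s, hle⟩ => ?_,
    fun h2 hdo hlt => ⟨?_, ?_⟩⟩
  · rintro ⟨z, hz, hsum⟩
    obtain ⟨x, hx1, hx2⟩ := exists_symmetric_weights z hz
    have hmem := vanishingWeightsIn_rootVal N x (hx1.trans hsum)
    rw [hx2, Fintype.card_fin] at hmem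
    generalize 2 * d = n at hmem
    induction hmem using AddSubmonoid.closure_induction with
    | mem l hl =>
      have hl' := Nat.mem_primeFactors.1 (Finset.mem_coe.1 hl)
      obtain ⟨i, rfl⟩ := hfactor l hl'.1 hl'.2.1
      exact ⟨Pi.single i 1, by simp [Pi.single_apply]⟩
    | zero => exact ⟨0, by simp⟩
    | add m n _ _ hm hn =>
      obtain ⟨b, rfl⟩ := hm
      obtain ⟨c, rfl⟩ := hn
      exact ⟨b + c, by simp [add_mul, Finset.sum_add_distrib]⟩
  · rintro ⟨b, hb⟩
    have hodd : ∀ i, Odd (p i) := fun i =>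
      (hp i).odd_of_ne_two fun h => h2 (h ▸ hdvd i)
    choose H hH1 hH2 hH3 using fun i => exists_half_polygon (hodd i) (hp i).ne_one (hdvd i)
    have hcount : 2 * (∑ i, b i * Multiset.card (H i)) + ∑ i, b i = 2 * d := by
      rw [hb, Finset.mul_sum, ← Finset.sum_add_distrib]
      refine Finset.sum_congr rfl fun i _ => ?_
      rw [← hH2 i]
      ring
    -- The half polygons contribute `-∑ b i`, which is even because all `p i` are odd; `k` copies of
    -- `1` contribute `2k` and cancel it.
    obtain ⟨k, hk⟩ : ∃ k, ∑ i, b i = 2 * k := ⟨d - ∑ i, b i * Multiset.card (H i), by omega⟩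
    have hcard : Multiset.card (∑ i, b i • H i + Multiset.replicate k 1) = d := by
      simp only [Multiset.card_add, Multiset.card_sum, Multiset.card_nsmul,
        Multiset.card_replicate]
      omega
    refine exists_fin_of_multiset _ hcard (fun z hz => ?_) ?_
    · rcases Multiset.mem_add.1 hz with h | h
      · obtain ⟨i, -, hi⟩ := Multiset.mem_sum.1 h
        exact hH1 i z (Multiset.mem_of_mem_nsmul hi)
      · rw [Multiset.eq_of_mem_replicate h, one_pow]
    · have hk' : (∑ i, (b i : ℂ)) = 2 * k := by exact_mod_cast hk
      rw [Multiset.map_add, Multiset.sum_add, ← Multiset.coe_mapAddMonoidHom, map_sum,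
        ← Multiset.coe_sumAddMonoidHom, map_sum]
      simp only [map_nsmul, Multiset.coe_mapAddMonoidHom, Multiset.coe_sumAddMonoidHom, hH3]
      simp [hk']
      ring
  · obtain ⟨k, rfl⟩ := hde
    exact exists_fin_of_multiset _ (by simp) (hpairs k h2) (by simp)
  · have hpo : Odd (p ⟨1, h1s⟩) := (hp _).odd_of_ne_two fun h => by
      have h01 : p ⟨0, by omega⟩ < p ⟨1, h1s⟩ := hmono (by simp)
      have := (hp ⟨0, by omega⟩).two_le
      omega
    obtain ⟨H, hH1, hH2, hH3⟩ := exists_half_polygon hpo (hp _).ne_one (hdvd _)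
    obtain ⟨k, hk⟩ : ∃ k, d = p ⟨1, h1s⟩ + 2 * k := by
      obtain ⟨m, hm⟩ := hdo
      exact ⟨m - Multiset.card H, by omega⟩
    -- Two half polygons and one `1` give `-1 - 1 + 2 = 0` using `p ⟨1, h1s⟩` roots; the remaining
    -- even number is filled with pairs `1, -1`.
    have hcard : Multiset.card (H + H + {1} + (Multiset.replicate k 1 + Multiset.replicate k (-1)))
        = d := by
      simp only [Multiset.card_add, Multiset.card_replicate, Multiset.card_singleton]
      omega
    refine exists_fin_of_multiset _ hcard (fun z hz => ?_) ?_
    · rcases Multiset.mem_add.1 hz with h | h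
      · rcases Multiset.mem_add.1 h with h | h
        · rcases Multiset.mem_add.1 h with h | h <;> exact hH1 z h
        · rw [Multiset.mem_singleton.1 h, one_pow]
      · exact hpairs k h2 z h
    · simp [hH3]
  · rintro ⟨z, hz, hsum⟩
    by_contra h4
    obtain ⟨M, rfl⟩ := h2
    have hMo : Odd M := by
      by_contra hMe
      obtain ⟨m, rfl⟩ := even_iff_two_dvd.1 (Nat.not_odd_iff_even.1 hMe)
      exact h4 ⟨m, by ring⟩
    have : NeZero M := ⟨by rintro rfl; simp at hMo⟩
    refine sum_add_inv_ne_zero hdo (fun l hl hlM => ?_) hMo z hz hsum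
    have hlo : Odd l := Odd.of_dvd_nat hMo hlM
    obtain ⟨i, rfl⟩ := hfactor l hl (hlM.mul_left 2)
    obtain ⟨i₂, hi₂⟩ := hfactor 2 Nat.prime_two (dvd_mul_right 2 M)
    have hlt2 : p i₂ < p i := by
      rw [← hi₂]
      exact lt_of_le_of_ne hl.two_le fun h => by rw [← h] at hlo; exact absurd hlo (by decide)
    -- Since `2` is among the `p i`, every odd prime factor has positive index and is at least the
    -- second prime.
    have hi : (i₂ : ℕ) < i := hmono.lt_iff_lt.1 hlt2
    have h1s : 1 < s := by omega
    exact ⟨hlo, (hlt h1s).trans_le (hmono.monotone (Fin.le_def.2 (by simp only; omega)))⟩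
  · rintro ⟨m, rfl⟩
    refine ⟨fun _ => Complex.I, fun _ => by rw [pow_mul, Complex.I_pow_four, one_pow], ?_⟩
    simp
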